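/- Call a triple $(a,b,c)$ of positive integers index-realizable if there exist a group $G$ and finite-index subgroups $H, K \leq G$ with $a=[G:H]$, $b=[G:K]$ and $c=[G:H\cap K]$. Call a triple $(a,b,c)$ of positive integers exceptional if one of the following holds: - $a=5$, $c=3b$ and $10\nmid b$; - $a=7$, $c=5b$ and $21\nmid b$; - $a=8$, $c=5b$ and $56\nmid b$; - $a=9$, $c=5b$ and $126\nmid b$; - $a=9$, $c=7b$ and $36\nmid b$; - $a=10$, $c=7b$ and $120\nmid b$. (In each case the modulus is $\binom{a}{c/b}$.) Let $a,b,c$ be positive integers. (1) If $a\le 10$, then $(a,b,c)$ is index-realizable if and only if $\operatorname{lcm}(a,b)\mid c$, $c\le ab$, and $(a,b,c)$ is not exceptional. (2) If $\min(a,b)\le 10$, then $(a,b,c)$ is index-realizable if and only if $\operatorname{lcm}(a,b)\mid c$, $c\le ab$, and neither $(a,b,c)$ nor $(b,a,c)$ is exceptional. -/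

import Mathlib

universe u

/-- A triple `(a, b, c)` is index-realizable if some group `G` has subgroups `H`, `K` of finite
index with `a = [G : H]`, `b = [G : K]` and `c = [G : H ∩ K]`. -/
def IndexRealizable (a b c : ℕ) : Prop :=
  ∃ (G : Type u) (_ : Group G) (H K : Subgroup G),
    H.FiniteIndex ∧ K.FiniteIndex ∧ a = H.index ∧ b = K.index ∧ c = (H ⊓ K).index

/-- The exceptional triples: `a ≤ 10`, `c = d * b`, with `(a, d)` one of six pairs, where `b` is not
a multiple of the binomial coefficient `a.choose d`. -/
def ExceptionalTriple (a b c : ℕ) : Prop :=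
  (a = 5 ∧ c = 3 * b ∧ ¬ 10 ∣ b) ∨
  (a = 7 ∧ c = 5 * b ∧ ¬ 21 ∣ b) ∨
  (a = 8 ∧ c = 5 * b ∧ ¬ 56 ∣ b) ∨
  (a = 9 ∧ c = 5 * b ∧ ¬ 126 ∣ b) ∨
  (a = 9 ∧ c = 7 * b ∧ ¬ 36 ∣ b) ∨
  (a = 10 ∧ c = 7 * b ∧ ¬ 120 ∣ b)

/-!
Throughout, write `c = d * b`. For subgroups `H`, `K` of `G`, the number `d` is the size of the
`K`-orbit of the base point of `G ⧸ H`, so index-realizability asks which `d`-element orbits a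
subgroup of index `b` can have in a transitive action of degree `a`. That `lcm a b ∣ c` and
`c ≤ a * b` are necessary is clear.

**Exceptional triples.** In all six families `d = p` is a prime with `a / 2 < p < a`. Then the image
of `K` in the symmetric group on `a` points contains an element of order `p`, which must be a
`p`-cycle since `a < 2 * p`. The existence of this cycle and `a < 2 * p` force `G` to be primitive,
and Jordan's theorem on primitive groups containing a subgroup that is primitive on its support
makes `G` `(a - p + 1)`-fold transitive. So `G` is transitive on sets of size `a - p`, hence on sets
of size `p`. As `K` stabilizes a set of size `p`, its index is a multiple of `a.choose p`
(`choose_dvd_index_of_ncard_orbit_eq`).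

**Realizations.** An incidence relation between finite sets `X` and `Y` with a group of
automorphisms transitive on flags, in which every element of `Y` is incident with `d` elements of
`X`, realizes `(|X|, |Y|, d * |Y|)`: take point stabilizers at the two ends of a flag
(`IndexRealizable.of_flag_transitive`). Disjointness of `k`-subsets and `l`-subsets of an `n`-set
(`IndexRealizable.kneser`), the polygons, and the flags and antiflags of the Fano plane give all
the basic triples. Realizable triples are closed under componentwise products, so dividing `a` and
`d` by their greatest common divisor reduces to the coprime case. There `b` is a multiple of `a`,
and `b = a` is realized except for the six exceptional pairs, for which `b = a.choose d` is. Among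
the pairs that are not coprime, only `(a, d) = (10, 6)` reduces to an exceptional pair, namely
`(5, 3)`; there the points and pairs of points of a 5-element set do the job.
-/

open MulAction

/-! ### Large prime orbits -/

/-- A transitive permutation group of degree `a` containing a cycle of prime length `p` with
`a / 2 < p < a` is transitive on `p`-element subsets. The group is primitive because more than half
of the points lie in the support of the cycle, on which the pointwise stabilizer of the complement
acts primitively; Jordan's theorem then gives transitivity on subsets of size `a - p`, and taking
complements concludes. -/
theorem isPretransitive_powersetCard_of_isCycle_mem {α : Type*} [Fintype α] [DecidableEq α]
    {G : Subgroup (Equiv.Perm α)} [IsPretransitive G α] {g : Equiv.Perm α} (hg : g ∈ G)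
    (hgc : g.IsCycle) (hp : g.support.card.Prime) (hlt : g.support.card < Fintype.card α)
    (hlt' : Fintype.card α < 2 * g.support.card) :
    IsPretransitive G (Set.powersetCard α g.support.card) := by
  set p := g.support.card
  have hcar : ((SubMulAction.ofFixingSubgroup G (g.support : Set α)ᶜ : Set α)) = g.support := by
    ext x
    simp [SubMulAction.mem_ofFixingSubgroup_iff]
  have hcard : Nat.card (SubMulAction.ofFixingSubgroup G (g.support : Set α)ᶜ) = p := by
    have := congrArg Set.ncard hcar
    rwa [Set.ncard_coe_finset, ← Nat.card_coe_set_eq] at this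
  have := Equiv.Perm.isPretransitive_of_isCycle_mem hgc hg
  have hprim : IsPreprimitive (fixingSubgroup G (g.support : Set α)ᶜ)
      (SubMulAction.ofFixingSubgroup G (g.support : Set α)ᶜ) :=
    .of_prime_card (hcard ▸ hp)
  have hG : IsPreprimitive G α := by
    let f : SubMulAction.ofFixingSubgroup G (g.support : Set α)ᶜ
        →ₑ[(fixingSubgroup G (g.support : Set α)ᶜ).subtype] α :=
      ⟨Subtype.val, fun _ _ => rfl⟩
    refine IsPreprimitive.of_card_lt (f := f) ?_
    have hr : Set.range f = g.support := Subtype.range_coe.trans hcar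
    rw [hr, Set.ncard_coe_finset, Nat.card_eq_fintype_card]
    exact hlt'
  obtain ⟨n, hn⟩ : ∃ n, Fintype.card α = p + n + 1 := ⟨Fintype.card α - p - 1, by omega⟩
  have hs : ((g.support : Set α)ᶜ).ncard = n + 1 := by
    rw [Set.ncard_compl, Set.ncard_coe_finset, Nat.card_eq_fintype_card]
    omega
  have h2 := hp.two_le
  have hcardα : Nat.card α = p + n + 1 := by rw [Nat.card_eq_fintype_card, hn]
  have hmp := hG.isMultiplyPreprimitive hs (by omega) hprim
  have hmt : IsMultiplyPretransitive G α (n + 1) :=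
    have := hmp.isMultiplyPretransitive
    isMultiplyPretransitive_of_le (n := n + 2) (by omega) (by omega)
  have := Set.powersetCard.isPretransitive_of_isMultiplyPretransitive G hmt
  exact IsPretransitive.of_surjective_map
    (Set.powersetCard.mulActionHom_compl_bijective G α (n := n + 1) (m := p) (by omega)).surjective
    this

/-- If a subgroup `K` has an orbit `D` of prime size `p` in a transitive action on `a` points, where
`a / 2 < p < a`, then `K` lies in the setwise stabilizer of `D`, which has index `a.choose p`
because the group is transitive on `p`-element sets. -/
theorem choose_dvd_index_of_ncard_orbit_eq {G X : Type*} [Group G] [MulAction G X] [Finite X]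
    [IsPretransitive G X] {p : ℕ} (hp : p.Prime) (hlt : p < Nat.card X) (hlt' : Nat.card X < 2 * p)
    (K : Subgroup G) (x : X) (hx : (orbit K x).ncard = p) :
    (Nat.card X).choose p ∣ K.index := by
  classical
  have := Fintype.ofFinite X
  let D : Set.powersetCard X p := ⟨(orbit K x).toFinset, by
    rw [Set.powersetCard.mem_iff, ← Set.ncard_eq_toFinset_card', hx]⟩
  have hDc : (D : Set X) = orbit K x := by
    change (((orbit K x).toFinset : Finset X) : Set X) = _
    exact Set.coe_toFinset _
  have hKD : K ≤ stabilizer G D := by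
    intro k hk
    rw [Set.powersetCard.stabilizer_coe, hDc]
    exact smul_orbit (⟨k, hk⟩ : K) x
  -- `G` may be infinite, so Cauchy's theorem is applied to the image of `K` in the symmetric group.
  let φ := toPermHom G X
  let M := K.map φ
  have horb : orbit M x = orbit K x := by
    ext y
    constructor
    · rintro ⟨⟨_, k, hk, rfl⟩, rfl⟩
      exact ⟨⟨k, hk⟩, rfl⟩
    · rintro ⟨⟨k, hk⟩, rfl⟩
      exact ⟨⟨φ k, k, hk, rfl⟩, rfl⟩
  have hdvd : p ∣ Nat.card M := by
    rw [← hx, ← horb, ← index_stabilizer]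
    exact Subgroup.index_dvd_card _
  have := Fact.mk hp
  obtain ⟨⟨g, hgM⟩, hg⟩ := exists_prime_orderOf_dvd_card' p hdvd
  have hgo : orderOf g = p := by rw [← hg, Subgroup.orderOf_mk]
  have hgc : g.IsCycle := Equiv.Perm.isCycle_of_prime_order' (by rwa [hgo])
    (by rw [hgo, ← Nat.card_eq_fintype_card]; exact hlt')
  have hsupp : g.support.card = p := by rw [← hgc.orderOf, hgo]
  have htrans : IsPretransitive φ.range X :=
    ⟨fun y z => (exists_smul_eq G y z).imp' (fun k => ⟨φ k, k, rfl⟩) fun _ h => h⟩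
  have hgr : g ∈ φ.range := by
    obtain ⟨k, _, rfl⟩ := hgM
    exact ⟨k, rfl⟩
  have ht := isPretransitive_powersetCard_of_isCycle_mem hgr hgc (hsupp ▸ hp)
    (by rw [hsupp, ← Nat.card_eq_fintype_card]; exact hlt)
    (by rw [hsupp, ← Nat.card_eq_fintype_card]; exact hlt')
  rw [hsupp] at ht
  have htG : IsPretransitive G (Set.powersetCard X p) := by
    refine ⟨fun s t => ?_⟩
    obtain ⟨⟨_, k, rfl⟩, h⟩ := exists_smul_eq φ.range s t
    refine ⟨k, ?_⟩
    rw [← h]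
    ext
    rfl
  rw [← Set.powersetCard.card, ← index_stabilizer_of_transitive G D]
  exact Subgroup.index_dvd_of_le hKD

namespace IndexRealizable

variable {a b c : ℕ}

theorem symm (h : IndexRealizable.{u} a b c) : IndexRealizable.{u} b a c := by
  obtain ⟨G, _, H, K, hH, hK, ha, hb, hc⟩ := h
  exact ⟨G, _, K, H, hK, hH, hb, ha, by rwa [inf_comm]⟩

theorem lcm_dvd (h : IndexRealizable.{u} a b c) : Nat.lcm a b ∣ c := by
  obtain ⟨G, _, H, K, hH, hK, rfl, rfl, rfl⟩ := h
  exact Nat.lcm_dvd (Subgroup.index_dvd_of_le inf_le_left) (Subgroup.index_dvd_of_le inf_le_right)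

theorem le_mul (h : IndexRealizable.{u} a b c) : c ≤ a * b := by
  obtain ⟨G, _, H, K, hH, hK, rfl, rfl, rfl⟩ := h
  exact Subgroup.index_inf_le

/-- The arithmetic obstruction behind the exceptional triples: `p` is the size of the `K`-orbit of
the base point of `G ⧸ H`. -/
theorem choose_dvd {p : ℕ} (h : IndexRealizable.{u} a b (p * b)) (hp : p.Prime) (hlt : p < a)
    (hlt' : a < 2 * p) : a.choose p ∣ b := by
  obtain ⟨G, _, H, K, hH, hK, rfl, rfl, hc⟩ := h
  have : Finite (G ⧸ H) := Subgroup.finite_quotient_of_finiteIndex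
  refine choose_dvd_index_of_ncard_orbit_eq (X := G ⧸ H) hp hlt hlt' K ((1 : G) : G ⧸ H) ?_
  refine (index_stabilizer ..).symm.trans ?_
  trans (H.subgroupOf K).index
  · congr 1
    ext k
    rw [mem_stabilizer_iff, Subgroup.mem_subgroupOf]
    change (((k : G) * 1 : G) : G ⧸ H) = _ ↔ _
    rw [mul_one, eq_comm, QuotientGroup.eq, inv_one, one_mul]
  refine Nat.eq_of_mul_eq_mul_right (Nat.pos_of_ne_zero hK.index_ne_zero) ?_
  rw [hc, ← Subgroup.relIndex_mul_index (inf_le_right : H ⊓ K ≤ K), Subgroup.inf_relIndex_right]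
  rfl

theorem not_exceptionalTriple (h : IndexRealizable.{u} a b c) : ¬ ExceptionalTriple a b c := by
  rintro (⟨rfl, rfl, hb⟩ | ⟨rfl, rfl, hb⟩ | ⟨rfl, rfl, hb⟩ | ⟨rfl, rfl, hb⟩ | ⟨rfl, rfl, hb⟩ |
    ⟨rfl, rfl, hb⟩) <;>
  exact hb (h.choose_dvd (by norm_num) (by norm_num) (by norm_num))

end IndexRealizable

/-! ### Realizations by flag-transitive incidence relations -/

namespace IndexRealizable

/-- Groups in the lowest universe realize triples in every universe. -/
theorem of_group {G : Type} [Group G] (H K : Subgroup G) [hH : H.FiniteIndex]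
    [hK : K.FiniteIndex] : IndexRealizable.{u} H.index K.index (H ⊓ K).index := by
  let f : ULift.{u} G →* G := MulEquiv.ulift.toMonoidHom
  have hf : Function.Surjective f := MulEquiv.ulift.surjective
  have hi (L : Subgroup G) : (L.comap f).index = L.index := L.index_comap_of_surjective hf
  refine ⟨ULift.{u} G, inferInstance, H.comap f, K.comap f, ⟨?_⟩, ⟨?_⟩, (hi H).symm, (hi K).symm,
    ?_⟩
  · exact (hi H).symm ▸ hH.index_ne_zero
  · exact (hi K).symm ▸ hK.index_ne_zero
  · rw [← Subgroup.comap_inf, hi]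

theorem mul {a b c a' b' c' : ℕ} (h : IndexRealizable.{u} a b c)
    (h' : IndexRealizable.{u} a' b' c') : IndexRealizable.{u} (a * a') (b * b') (c * c') := by
  obtain ⟨G, _, H, K, hH, hK, rfl, rfl, rfl⟩ := h
  obtain ⟨G', _, H', K', hH', hK', rfl, rfl, rfl⟩ := h'
  have hinf : H.prod H' ⊓ K.prod K' = (H ⊓ K).prod (H' ⊓ K') := by
    ext
    simp only [Subgroup.mem_inf, Subgroup.mem_prod]
    tauto
  refine ⟨G × G', inferInstance, H.prod H', K.prod K', ⟨?_⟩, ⟨?_⟩, (H.index_prod H').symm,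
    (K.index_prod K').symm, ?_⟩
  · rw [Subgroup.index_prod]
    exact mul_ne_zero hH.index_ne_zero hH'.index_ne_zero
  · rw [Subgroup.index_prod]
    exact mul_ne_zero hK.index_ne_zero hK'.index_ne_zero
  · rw [hinf, Subgroup.index_prod]

/-- A flag-transitive action on an incidence relation `R`, in which each `y` is incident with
exactly `d` elements, realizes `(|X|, |Y|, d * |Y|)`: the stabilizers of `x₀` and `y₀`, for a flag
`(x₀, y₀)`, meet in the stabilizer of the flag, whose index is the number of flags. -/
theorem of_flag_transitive {G X Y : Type} [Group G] [MulAction G X] [MulAction G Y] [Finite X]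
    [Finite Y] [Nonempty Y] (R : X → Y → Prop) {d : ℕ} (hd : d ≠ 0)
    (hRd : ∀ y, {x | R x y}.ncard = d) (hX : ∀ x, ∃ y, R x y)
    (hR : ∀ (g : G) x y, R x y → R (g • x) (g • y))
    (htrans : ∀ x y x' y', R x y → R x' y' → ∃ g : G, g • x = x' ∧ g • y = y') :
    IndexRealizable.{u} (Nat.card X) (Nat.card Y) (d * Nat.card Y) := by
  have hY (y : Y) : ∃ x, R x y := 
    Set.nonempty_of_ncard_ne_zero (s := {x | R x y}) (by rw [hRd y]; exact hd)
  have : IsPretransitive G X := ⟨fun x x' => by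
    obtain ⟨y, hy⟩ := hX x
    obtain ⟨y', hy'⟩ := hX x'
    exact (htrans x y x' y' hy hy').imp fun _ => And.left⟩
  have : IsPretransitive G Y := ⟨fun y y' => by
    obtain ⟨x, hx⟩ := hY y
    obtain ⟨x', hx'⟩ := hY y'
    exact (htrans x y x' y' hx hx').imp fun _ => And.right⟩
  obtain ⟨y₀⟩ := ‹Nonempty Y›
  obtain ⟨x₀, h₀⟩ := hY y₀
  have hinf : stabilizer G x₀ ⊓ stabilizer G y₀ = stabilizer G (x₀, y₀) := by
    ext g
    simp [mem_stabilizer_iff]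
  have horb : orbit G (x₀, y₀) = {p : X × Y | R p.1 p.2} := by
    ext ⟨x, y⟩
    constructor
    · rintro ⟨g, hg⟩
      obtain ⟨rfl, rfl⟩ := Prod.ext_iff.1 hg
      exact hR g _ _ h₀
    · intro h
      obtain ⟨g, rfl, rfl⟩ := htrans _ _ _ _ h₀ h
      exact ⟨g, rfl⟩
  have hcount : {p : X × Y | R p.1 p.2}.ncard = d * Nat.card Y := by
    have e : {p : X × Y | R p.1 p.2} ≃ Σ y : Y, {x | R x y} :=
      { toFun p := ⟨p.1.2, p.1.1, p.2⟩
        invFun q := ⟨(q.2.1, q.1), q.2.2⟩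
        left_inv _ := rfl
        right_inv _ := rfl }
    have := Fintype.ofFinite Y
    rw [← Nat.card_coe_set_eq, Nat.card_congr e, Nat.card_sigma]
    simp only [Nat.card_coe_set_eq, hRd, Finset.sum_const, Finset.card_univ, smul_eq_mul,
      Nat.card_eq_fintype_card, mul_comm]
  have : (stabilizer G x₀).FiniteIndex := ⟨by
    have : Nonempty X := ⟨x₀⟩
    rw [index_stabilizer_of_transitive]
    exact Nat.card_pos.ne'⟩
  have : (stabilizer G y₀).FiniteIndex := ⟨by
    have : Nonempty Y := ⟨y₀⟩
    rw [index_stabilizer_of_transitive]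
    exact Nat.card_pos.ne'⟩
  have := of_group.{u} (stabilizer G x₀) (stabilizer G y₀)
  rwa [index_stabilizer_of_transitive, index_stabilizer_of_transitive, hinf, index_stabilizer,
    horb, hcount] at this

end IndexRealizable

/-- The automorphism group of an incidence relation: pairs of permutations, of the points and of the
blocks, that together preserve and reflect incidence. -/
def incidenceAut {X Y : Type} (R : X → Y → Prop) : Subgroup (Equiv.Perm X × Equiv.Perm Y) where
  carrier := {g | ∀ x y, R (g.1 x) (g.2 y) ↔ R x y}
  one_mem' _ _ := Iff.rfl
  mul_mem' {g h} hg hh x y := (hg (h.1 x) (h.2 y)).trans (hh x y)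
  inv_mem' {g} hg x y := by
    simpa using (hg (g.1⁻¹ x) (g.2⁻¹ y)).symm

namespace IndexRealizable

theorem of_incidenceAut {X Y : Type} [Finite X] [Finite Y] [Nonempty Y] (R : X → Y → Prop) {d : ℕ}
    (hd : d ≠ 0) (hRd : ∀ y, {x | R x y}.ncard = d) (hX : ∀ x, ∃ y, R x y) (x₀ : X) (y₀ : Y)
    (htrans : ∀ x y, R x y → ∃ g ∈ incidenceAut R, g.1 x₀ = x ∧ g.2 y₀ = y) :
    IndexRealizable.{u} (Nat.card X) (Nat.card Y) (d * Nat.card Y) := by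
  let _ : MulAction (incidenceAut R) X :=
    .compHom X ((MonoidHom.fst _ _).comp (incidenceAut R).subtype)
  let _ : MulAction (incidenceAut R) Y :=
    .compHom Y ((MonoidHom.snd _ _).comp (incidenceAut R).subtype)
  refine of_flag_transitive (G := incidenceAut R) R hd hRd hX (fun g x y h => (g.2 x y).2 h) ?_
  intro x y x' y' h h'
  obtain ⟨g, hg, rfl, rfl⟩ := htrans x y h
  obtain ⟨g', hg', rfl, rfl⟩ := htrans x' y' h'
  refine ⟨⟨g', hg'⟩ * ⟨g, hg⟩⁻¹, ?_, ?_⟩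
  · change (g'.1 * g.1⁻¹) (g.1 x₀) = _
    simp
  · change (g'.2 * g.2⁻¹) (g.2 y₀) = _
    simp

end IndexRealizable

/-! ### Subsets, polygons and the Fano plane -/

open scoped Pointwise in
/-- The symmetric group is transitive on pairs of disjoint subsets of prescribed sizes. -/
theorem exists_perm_smul_eq_of_disjoint {α : Type*} [Fintype α] [DecidableEq α]
    {s t s' t' : Finset α} (h : Disjoint s t) (h' : Disjoint s' t') (hs : s.card = s'.card)
    (ht : t.card = t'.card) : ∃ g : Equiv.Perm α, g • s = s' ∧ g • t = t' := by
  obtain ⟨e⟩ : Nonempty (s ≃ s') := ⟨Finset.equivOfCardEq hs⟩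
  obtain ⟨f⟩ : Nonempty (t ≃ t') := ⟨Finset.equivOfCardEq ht⟩
  let F : {x // x ∈ s ∪ t} ≃ {x // x ∈ s' ∪ t'} :=
    (Equiv.Finset.union s t h).symm.trans ((e.sumCongr f).trans (Equiv.Finset.union s' t' h'))
  let g : Equiv.Perm α := F.extendSubtype
  have hgs : ∀ x ∈ s, g x ∈ s' := fun x hx => by
    have hx' : x ∈ s ∪ t := Finset.mem_union_left _ hx
    have : (Equiv.Finset.union s t h).symm ⟨x, hx'⟩ = Sum.inl ⟨x, hx⟩ := by
      rw [Equiv.symm_apply_eq]; rfl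
    have hF : F ⟨x, hx'⟩ = Equiv.Finset.union s' t' h' (Sum.inl (e ⟨x, hx⟩)) := by
      simp only [F, Equiv.trans_apply, this]
      rfl
    simp only [g]
    rw [F.extendSubtype_apply_of_mem x hx', hF]
    exact (e ⟨x, hx⟩).2
  have hgt : ∀ x ∈ t, g x ∈ t' := fun x hx => by
    have hx' : x ∈ s ∪ t := Finset.mem_union_right _ hx
    have : (Equiv.Finset.union s t h).symm ⟨x, hx'⟩ = Sum.inr ⟨x, hx⟩ := by
      rw [Equiv.symm_apply_eq]; rfl
    have hF : F ⟨x, hx'⟩ = Equiv.Finset.union s' t' h' (Sum.inr (f ⟨x, hx⟩)) := by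
      simp only [F, Equiv.trans_apply, this]
      rfl
    simp only [g]
    rw [F.extendSubtype_apply_of_mem x hx', hF]
    exact (f ⟨x, hx⟩).2
  refine ⟨g, Finset.eq_of_subset_of_card_le ?_ ?_, Finset.eq_of_subset_of_card_le ?_ ?_⟩
  · exact fun y hy => by
      obtain ⟨x, hx, rfl⟩ := Finset.mem_smul_finset.1 hy
      exact hgs x hx
  · rw [Finset.card_smul_finset, hs]
  · exact fun y hy => by
      obtain ⟨x, hx, rfl⟩ := Finset.mem_smul_finset.1 hy
      exact hgt x hx
  · rw [Finset.card_smul_finset, ht]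

namespace IndexRealizable

open scoped Pointwise in
/-- The stabilizers in the symmetric group of a `k`-subset and of an `l`-subset disjoint from it. -/
theorem kneser {n k l : ℕ} (hkl : k + l ≤ n) :
    IndexRealizable.{u} (n.choose k) (n.choose l) ((n - l).choose k * n.choose l) := by
  let X := Set.powersetCard (Fin n) k
  let Y := Set.powersetCard (Fin n) l
  have hcX : Nat.card X = n.choose k := by
    rw [Set.powersetCard.card, Nat.card_fin]
  have hcY : Nat.card Y = n.choose l := by
    rw [Set.powersetCard.card, Nat.card_fin]
  have : Nonempty Y := by
    rw [← not_isEmpty_iff]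
    intro
    have := (Nat.choose_pos (show l ≤ n by omega)).ne'
    exact this (hcY ▸ Nat.card_of_isEmpty)
  rw [← hcX, ← hcY]
  refine of_flag_transitive (G := Equiv.Perm (Fin n))
    (fun (s : X) (t : Y) => Disjoint (s : Finset (Fin n)) t)
    (Nat.choose_pos (by omega)).ne' ?_ ?_ ?_ ?_
  · intro t
    have : Subtype.val '' {s : X | Disjoint (s : Finset (Fin n)) (t : Finset (Fin n))} =
        ((t : Finset (Fin n))ᶜ.powersetCard k : Set (Finset (Fin n))) := by
      ext s
      simp only [Set.mem_image, Set.mem_ofPred_eq, Finset.mem_coe, Finset.mem_powersetCard,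
        Finset.subset_compl_iff_disjoint_right]
      constructor
      · rintro ⟨s, hs, rfl⟩
        exact ⟨hs, s.2⟩
      · rintro ⟨hs, hs'⟩
        exact ⟨⟨s, hs'⟩, hs, rfl⟩
    rw [← Set.ncard_image_of_injective _ Subtype.val_injective, this, Set.ncard_coe_finset,
      Finset.card_powersetCard, Finset.card_compl, Fintype.card_fin, Set.powersetCard.card_eq]
  · intro s
    obtain ⟨t, hts, ht⟩ := Finset.exists_subset_card_eq (n := l) (s := (s : Finset (Fin n))ᶜ)
      (by rw [Finset.card_compl, Fintype.card_fin, Set.powersetCard.card_eq]; omega)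
    exact ⟨⟨t, ht⟩, (Finset.subset_compl_iff_disjoint_right.1 hts).symm⟩
  · intro g s t h
    rw [Set.powersetCard.coe_smul, Set.powersetCard.coe_smul]
    rw [Finset.disjoint_iff_inter_eq_empty, ← Finset.smul_finset_inter,
      Finset.disjoint_iff_inter_eq_empty.1 h, Finset.smul_finset_empty]
  · intro s t s' t' h h'
    obtain ⟨g, hs, ht⟩ := exists_perm_smul_eq_of_disjoint h h'
      (by simp only [Set.powersetCard.card_eq]) (by simp only [Set.powersetCard.card_eq])
    exact ⟨g, Subtype.ext hs, Subtype.ext ht⟩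

/-- The stabilizers of a vertex and an edge through it in the symmetry group of the `n`-gon, with
vertices `x` and edges `{y - 1, y}` indexed by `ZMod n`. -/
theorem polygon (n : ℕ) (hn : 2 ≤ n) : IndexRealizable.{u} n n (2 * n) := by
  have : NeZero n := ⟨by omega⟩
  have : Fact (1 < n) := ⟨hn⟩
  suffices IndexRealizable.{u} (Nat.card (ZMod n)) (Nat.card (ZMod n))
    (2 * Nat.card (ZMod n)) by rwa [Nat.card_zmod] at this
  refine of_incidenceAut (fun x y : ZMod n => y = x ∨ y = x + 1) two_ne_zero ?_
    (fun x => ⟨x, .inl rfl⟩) 0 0 ?_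
  · intro y
    rw [← Set.ncard_pair (show y ≠ y - 1 from fun h => one_ne_zero (sub_eq_self.1 h.symm))]
    congr 1
    ext x
    simp [eq_comm, eq_sub_iff_add_eq]
  · intro x y h
    rcases h with h | h
    · refine ⟨(Equiv.addRight x, Equiv.addRight x), fun u v => ?_, by simp, by simp [h]⟩
      simp [add_right_comm u x 1]
    · refine ⟨(Equiv.subLeft x, Equiv.subLeft (x + 1)), fun u v => ?_, by simp, by simp [h]⟩
      simp only [Equiv.subLeft_apply]
      grind

/-- The Fano plane as a difference set: points and lines are both indexed by `ZMod 7`, and the line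
`y` is the translate `y + {1, 2, 4}`. -/
def FanoIncident (x y : ZMod 7) : Prop := x - y = 1 ∨ x - y = 2 ∨ x - y = 4

instance decidableRelFanoIncident : DecidableRel FanoIncident :=
  fun _ _ => inferInstanceAs (Decidable (_ ∨ _))

/-- Translation of points and lines by `t`. -/
def fanoTranslation (t : ZMod 7) : incidenceAut FanoIncident :=
  ⟨(Equiv.addRight t, Equiv.addRight t), fun x y => by simp [FanoIncident]⟩

/-- Multiplication by `2` on points and lines; it preserves the difference set `{1, 2, 4}`. -/
def fanoDoubling : incidenceAut FanoIncident :=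
  ⟨(⟨(2 * ·), (4 * ·), by decide, by decide⟩, ⟨(2 * ·), (4 * ·), by decide, by decide⟩),
    show ∀ x y, FanoIncident _ _ ↔ FanoIncident x y by decide⟩

/-- The involution that fixes every point of the line `{1, 2, 4}` and every line through the
point `1`. -/
def fanoElation : incidenceAut FanoIncident :=
  ⟨(Equiv.swap 0 3 * Equiv.swap 5 6, Equiv.swap 1 5 * Equiv.swap 2 3),
    show ∀ x y, FanoIncident _ _ ↔ FanoIncident x y by decide⟩

theorem fano_flag_transitive (x y : ZMod 7) (h : FanoIncident x y) :
    ∃ g : incidenceAut FanoIncident, g.1.1 1 = x ∧ g.1.2 0 = y := by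
  have key : ∀ x y, FanoIncident x y → ∃ k : Fin 3,
      (fanoTranslation y * fanoDoubling ^ (k : ℕ)).1.1 1 = x ∧
      (fanoTranslation y * fanoDoubling ^ (k : ℕ)).1.2 0 = y := by
    decide
  obtain ⟨k, hk⟩ := key x y h
  exact ⟨_, hk⟩

theorem fano_antiflag_transitive (x y : ZMod 7) (h : ¬ FanoIncident x y) :
    ∃ g : incidenceAut FanoIncident, g.1.1 0 = x ∧ g.1.2 0 = y := by
  -- The four points off the line `0` are `0` and the three points `3 * 2 ^ k`.
  have key : ∀ x y, ¬ FanoIncident x y → ∃ (k : Fin 3) (e : Fin 2),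
      (fanoTranslation y * fanoDoubling ^ (k : ℕ) * fanoElation ^ (e : ℕ)).1.1 0 = x ∧
      (fanoTranslation y * fanoDoubling ^ (k : ℕ) * fanoElation ^ (e : ℕ)).1.2 0 = y := by
    decide
  obtain ⟨k, e, hk⟩ := key x y h
  exact ⟨_, hk⟩

/-- The flags of the Fano plane. -/
theorem fano_flag : IndexRealizable.{u} 7 7 (3 * 7) := by
  suffices IndexRealizable.{u} (Nat.card (ZMod 7)) (Nat.card (ZMod 7))
    (3 * Nat.card (ZMod 7)) by rwa [Nat.card_zmod] at this
  refine of_incidenceAut FanoIncident three_ne_zero ?_ (by decide) 1 0 ?_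
  · intro y
    rw [Set.ncard_eq_toFinset_card']
    revert y
    decide
  · intro x y h
    obtain ⟨g, hg⟩ := fano_flag_transitive x y h
    exact ⟨g.1, g.2, hg⟩

/-- The pairs of a point and a line not through it in the Fano plane. -/
theorem fano_antiflag : IndexRealizable.{u} 7 7 (4 * 7) := by
  suffices IndexRealizable.{u} (Nat.card (ZMod 7)) (Nat.card (ZMod 7))
    (4 * Nat.card (ZMod 7)) by rwa [Nat.card_zmod] at this
  refine of_incidenceAut (fun x y => ¬ FanoIncident x y) four_ne_zero ?_ (by decide) 0 0 ?_
  · intro y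
    rw [Set.ncard_eq_toFinset_card']
    revert y
    decide
  · intro x y h
    obtain ⟨g, hg⟩ := fano_antiflag_transitive x y h
    exact ⟨g.1, fun u v => not_congr (g.2 u v), hg⟩

/-! ### Sufficiency of the numerical conditions -/

theorem one_left (m : ℕ) (hm : 0 < m) : IndexRealizable.{u} 1 m m := by
  simpa using kneser.{u} (n := m) (k := 0) (l := 1) (by omega)

theorem self (n : ℕ) (hn : 0 < n) : IndexRealizable.{u} n n n := by
  have := kneser.{u} (n := n) (k := 1) (l := n - 1) (by omega)
  rwa [Nat.choose_one_right, Nat.choose_one_right, Nat.choose_symm hn, Nat.choose_one_right,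
    show n - (n - 1) = 1 by omega, one_mul] at this

theorem pred_mul (n : ℕ) (hn : 2 ≤ n) : IndexRealizable.{u} n n ((n - 1) * n) := by
  simpa using kneser.{u} (n := n) (k := 1) (l := 1) (by omega)

/-- The stabilizers of a point and of a `d`-subset containing it; equivalently, of a point and the
complementary subset, which avoids it. -/
theorem choose_mul (n d : ℕ) (hd : d ≤ n) (hd0 : 0 < d) :
    IndexRealizable.{u} n (n.choose d) (d * n.choose d) := by
  have := kneser.{u} (n := n) (k := 1) (l := n - d) (by omega)
  rwa [Nat.choose_one_right, Nat.choose_one_right, Nat.choose_symm hd,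
    Nat.sub_sub_self hd] at this

/-- For fixed `a` and `d`, the values of `b` that can be realized are closed under multiples. -/
theorem of_dvd {a b₀ d b : ℕ} (h : IndexRealizable.{u} a b₀ (d * b₀)) (hb : b₀ ∣ b) (hb0 : 0 < b) :
    IndexRealizable.{u} a b (d * b) := by
  obtain ⟨m, rfl⟩ := hb
  have := h.mul (one_left.{u} m (Nat.pos_of_mul_pos_left hb0))
  rwa [mul_one, mul_assoc] at this

/-- Replacing each point by `g` copies. -/
theorem scale {a b d : ℕ} (h : IndexRealizable.{u} a b (d * b)) (g : ℕ) (hg : 0 < g) :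
    IndexRealizable.{u} (a * g) b (d * g * b) := by
  have := h.mul (one_left.{u} g hg).symm
  rwa [mul_one, mul_right_comm] at this

/-- For coprime `a` and `d` outside the six exceptional pairs, the smallest value `b = a` allowed by
divisibility is realized. -/
theorem of_coprime {a d : ℕ} (ha : a ≤ 10) (hd : 0 < d) (hda : d ≤ a) (hcop : a.Coprime d)
    (hne : (a, d) ∉ [(5, 3), (7, 5), (8, 5), (9, 5), (9, 7), (10, 7)]) :
    IndexRealizable.{u} a a (d * a) := by
  have key : d = 1 ∨ d = a - 1 ∨ d = 2 ∨
      (a, d) ∈ [(7, 3), (7, 4), (8, 3), (9, 4), (10, 3)] := by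
    interval_cases a <;> interval_cases d <;> revert hcop hne <;> decide
  rcases key with rfl | rfl | rfl | h
  · simpa using self.{u} a (by omega)
  · exact pred_mul a (by omega)
  · exact polygon a hda
  · simp only [List.mem_cons, Prod.mk.injEq, List.not_mem_nil, or_false] at h
    rcases h with ⟨rfl, rfl⟩ | ⟨rfl, rfl⟩ | ⟨rfl, rfl⟩ | ⟨rfl, rfl⟩ | ⟨rfl, rfl⟩
    · exact fano_flag
    · exact fano_antiflag
    · -- `(8, 3) = (2, 1) * (4, 3)` and `(9, 4) = (3, 2) * (3, 2)`.
      exact (self.{u} 2 two_pos).mul (pred_mul.{u} 4 (by omega))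
    · exact (pred_mul.{u} 3 (by omega)).mul (pred_mul.{u} 3 (by omega))
    · -- adjacent vertices of the Petersen graph
      exact kneser.{u} (n := 5) (k := 2) (l := 2) (by omega)

theorem of_not_exceptionalTriple {a b c : ℕ} (ha : 0 < a) (hb : 0 < b) (hc : 0 < c) (ha' : a ≤ 10)
    (hdvd : Nat.lcm a b ∣ c) (hle : c ≤ a * b) (hne : ¬ ExceptionalTriple a b c) :
    IndexRealizable.{u} a b c := by
  obtain ⟨d, hd⟩ : b ∣ c := (Nat.dvd_lcm_right a b).trans hdvd
  rw [mul_comm] at hd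
  subst hd
  have hd : 0 < d := Nat.pos_of_mul_pos_right hc
  have hda : d ≤ a := Nat.le_of_mul_le_mul_right hle hb
  have hadvd : a ∣ d * b := (Nat.dvd_lcm_left a b).trans hdvd
  obtain ⟨g, a', d', hg, hcop, rfl, rfl⟩ := Nat.exists_coprime' (Nat.gcd_pos_of_pos_left d ha)
  have ha'b : a' ∣ b := by
    refine hcop.dvd_of_dvd_mul_left (Nat.dvd_of_mul_dvd_mul_right hg ?_)
    rwa [mul_right_comm] at hadvd
  have hd'a' : d' ≤ a' := Nat.le_of_mul_le_mul_right hda hg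
  have hle' : a' ≤ a' * g := Nat.le_mul_of_pos_right _ hg
  by_cases h : (a', d') ∈ [(5, 3), (7, 5), (8, 5), (9, 5), (9, 7), (10, 7)]
  · have hd'0 : 0 < d' := Nat.pos_of_mul_pos_right hd
    by_cases hg1 : g = 1
    · subst hg1
      refine of_dvd (b₀ := a'.choose d') ?_ ?_ hb
      · simpa using choose_mul.{u} a' d' hd'a' hd'0
      · simp only [List.mem_cons, Prod.mk.injEq, List.not_mem_nil, or_false] at h
        simp only [ExceptionalTriple, not_or, not_and, not_not, mul_one] at hne
        obtain ⟨h1, h2, h3, h4, h5, h6⟩ := hne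
        rcases h with ⟨rfl, rfl⟩ | ⟨rfl, rfl⟩ | ⟨rfl, rfl⟩ | ⟨rfl, rfl⟩ | ⟨rfl, rfl⟩ | ⟨rfl, rfl⟩
        · exact h1 rfl rfl
        · exact h2 rfl rfl
        · exact h3 rfl rfl
        · exact h4 rfl rfl
        · exact h5 rfl rfl
        · exact h6 rfl rfl
    · -- Only `5` admits a proper multiple that is at most `10`.
      simp only [List.mem_cons, Prod.mk.injEq, List.not_mem_nil, or_false] at h
      obtain ⟨rfl, rfl⟩ : a' = 5 ∧ d' = 3 := by
        have : a' * 2 ≤ a' * g := Nat.mul_le_mul_left _ (by omega)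
        omega
      obtain rfl : g = 2 := by omega
      exact of_dvd (kneser.{u} (n := 5) (k := 2) (l := 1) (by omega)) ha'b hb
  · exact of_dvd (scale (of_coprime.{u} (by omega) (Nat.pos_of_mul_pos_right hd) hd'a' hcop h) g hg)
      ha'b hb

theorem iff_of_left_le {a b c : ℕ} (ha : 0 < a) (hb : 0 < b) (hc : 0 < c) (ha' : a ≤ 10) :
    IndexRealizable.{u} a b c ↔ Nat.lcm a b ∣ c ∧ c ≤ a * b ∧ ¬ ExceptionalTriple a b c :=
  ⟨fun h => ⟨h.lcm_dvd, h.le_mul, h.not_exceptionalTriple⟩,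
    fun h => of_not_exceptionalTriple ha hb hc ha' h.1 h.2.1 h.2.2⟩

end IndexRealizable

theorem mainTheorem4 :
    (∀ a b c : ℕ, 0 < a → 0 < b → 0 < c → a ≤ 10 →
      (IndexRealizable.{u} a b c ↔
        Nat.lcm a b ∣ c ∧ c ≤ a * b ∧ ¬ ExceptionalTriple a b c)) ∧
    (∀ a b c : ℕ, 0 < a → 0 < b → 0 < c → min a b ≤ 10 →
      (IndexRealizable.{u} a b c ↔
        Nat.lcm a b ∣ c ∧ c ≤ a * b ∧ ¬ ExceptionalTriple a b c ∧ ¬ ExceptionalTriple b a c)) := by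
  refine ⟨fun a b c ha hb hc ha' => IndexRealizable.iff_of_left_le ha hb hc ha',
    fun a b c ha hb hc hab => ⟨fun h => ⟨h.lcm_dvd, h.le_mul, h.not_exceptionalTriple,
      h.symm.not_exceptionalTriple⟩, ?_⟩⟩
  rintro ⟨hdvd, hle, h, h'⟩
  rcases min_le_iff.1 hab with ha' | hb'
  · exact (IndexRealizable.iff_of_left_le ha hb hc ha').2 ⟨hdvd, hle, h⟩
  · exact ((IndexRealizable.iff_of_left_le hb ha hc hb').2
      ⟨Nat.lcm_comm a b ▸ hdvd, mul_comm a b ▸ hle, h'⟩).symm
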